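/- There is an absolute constant $C>0$ such that the following holds for every $p\in[1,\infty]$, all integers $r\ge 16$ and $m\ge 1$, and every $\sigma\ge 0$. Put $T=2r$. Let $\mathscr H_r$ be the space of length-$r$ FIR filters $G(z)=\sum_{k=0}^{r-1} g_k z^{-k}$ with $g=(g_k)\in\mathbb C^r$ (given the Borel $\sigma$-algebra of $\mathbb C^r$), let $\mathscr H_r^{\mathbb R}\subset\mathscr H_r$ be the filters with real coefficients, and let $\|G\|_\infty=\sup_{|z|=1}|G(z)|$. For $u\in\mathbb C^T$ let $(g*u)_k=\sum_{0\le j\le\min(k,r-1)} g_j u_{k-j}$, $0\le k\le T-1$. (Real setting.) Fix inputs $u_1,\dots,u_m\in\mathbb R^T$ with $\|u_i\|_p\le 1$ for all $i$. For $G\in\mathscr H_r^{\mathbb R}$ let $Y=(Y_1,\dots,Y_m)$ with $Y_i=g*u_i+\xi_i$, where the $\xi_i\sim N(0,\sigma^2 I_T)$ are independent. Then $$\inf_{\widehat G}\ \sup_{G\in\mathscr H_r^{\mathbb R}} \mathbb E\,\|\widehat G(Y)-G\|_\infty\ \ge\ C\sigma\sqrt{\frac{r^{2/\max(p,2)}\log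 r}{m}},$$ where the infimum is over all measurable maps $\widehat G:(\mathbb R^T)^m\to\mathscr H_r$ (and $2/\max(p,2)=0$ when $p=\infty$). (Complex setting.) Fix inputs $u_1,\dots,u_m\in\mathbb C^T$ with $\|u_i\|_p\le 1$ for all $i$. For $G\in\mathscr H_r$ let $Y_i=g*u_i+\xi_i$, where the real and imaginary parts of all the coordinates of $\xi_1,\dots,\xi_m$ are independent $N(0,\sigma^2)$ variables. Then, with the same constant $C$, $$\inf_{\widehat G}\ \sup_{G\in\mathscr H_r} \mathbb E\,\|\widehat G(Y)-G\|_\infty\ \ge\ C\sigma\sqrt{\frac{r^{2/\max(p,2)}\log r}{m}},$$ where the infimum is over all measurable maps $\widehat G:(\mathbb C^T)^m\to\mathscr H_r$. -/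

import Mathlib

open MeasureTheory ProbabilityTheory
open scoped NNReal ENNReal

noncomputable section

namespace FIRIdent

/-- A length-`r` FIR filter `G(z) = ∑_{k<r} g_k z^{-k}`, given by its coefficients `g ∈ ℂ^r`
(with the Borel σ-algebra of `ℂ^r`). -/
abbrev FIRFilter (r : ℕ) : Type := Fin r → ℂ

/-- The transfer function `G(z) = ∑_{k<r} g_k z^{-k}`. -/
def transfer {r : ℕ} (g : FIRFilter r) (z : ℂ) : ℂ :=
  ∑ k : Fin r, g k * (z ^ (k : ℕ))⁻¹

/-- The `H∞` norm: the supremum of `|G(z)|` over the unit circle. -/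
def hinfNorm {r : ℕ} (g : FIRFilter r) : ℝ≥0∞ :=
  ⨆ z : Circle, ‖transfer g (z : ℂ)‖ₑ

/-- The real filters among the FIR filters. -/
def ofRealFilter {r : ℕ} (g : Fin r → ℝ) : FIRFilter r := fun k => (g k : ℂ)

/-- The first `T` outputs `(g * u)_k = ∑_{j + l = k} g_j u_l`, `k < T`, of the filter with
impulse response `g` (zero from index `r` on) on the input `u` of length `T`. -/
def conv {R : Type*} [Semiring R] {r T : ℕ} (g : Fin r → R) (u : Fin T → R) : Fin T → R :=
  fun k => ∑ j : Fin r, ∑ l : Fin T, if (j : ℕ) + (l : ℕ) = (k : ℕ) then g j * u l else 0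

/-- The law of `m` independent noisy real measurements `Y_i = (g * u_i) + ξ_i`,
`ξ_i ∼ N(0, σ² I_T)`. -/
def realLaw {r T m : ℕ} (σ : ℝ≥0) (u : Fin m → Fin T → ℝ) (g : Fin r → ℝ) :
    Measure (Fin m → Fin T → ℝ) :=
  Measure.pi fun i => Measure.pi fun t => gaussianReal (conv g (u i) t) (σ ^ 2)

/-- The law of `μ + √v (w₁ + i w₂)` with `w₁, w₂` independent standard real Gaussians. -/
def complexGaussian (μ : ℂ) (v : ℝ≥0) : Measure ℂ :=
  ((gaussianReal μ.re v).prod (gaussianReal μ.im v)).map fun x => (⟨x.1, x.2⟩ : ℂ)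

/-- The law of `m` independent noisy complex measurements `Y_i = (g * u_i) + ξ_i`, where the real
and imaginary parts of the coordinates of the `ξ_i` are independent `N(0, σ²)`. -/
def complexLaw {r T m : ℕ} (σ : ℝ≥0) (u : Fin m → Fin T → ℂ) (g : FIRFilter r) :
    Measure (Fin m → Fin T → ℂ) :=
  Measure.pi fun i => Measure.pi fun t => complexGaussian (conv g (u i) t) (σ ^ 2)

/-- `inf_Ĝ sup_G E ‖Ĝ - G‖_∞` for real inputs, real data and real filters `G`. The infimum is over
all measurable maps from the data to length-`r` FIR filters, complex coefficients being allowed. -/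
def realMinimaxRisk (r : ℕ) {T m : ℕ} (σ : ℝ≥0) (u : Fin m → Fin T → ℝ) : ℝ≥0∞ :=
  ⨅ (Ghat : (Fin m → Fin T → ℝ) → FIRFilter r) (_ : Measurable Ghat),
    ⨆ g : Fin r → ℝ, ∫⁻ Y, hinfNorm (Ghat Y - ofRealFilter g) ∂(realLaw σ u g)

/-- `inf_Ĝ sup_G E ‖Ĝ - G‖_∞` for complex inputs, complex data and complex filters `G`. -/
def complexMinimaxRisk (r : ℕ) {T m : ℕ} (σ : ℝ≥0) (u : Fin m → Fin T → ℂ) : ℝ≥0∞ :=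
  ⨅ (Ghat : (Fin m → Fin T → ℂ) → FIRFilter r) (_ : Measurable Ghat),
    ⨆ g : FIRFilter r, ∫⁻ Y, hinfNorm (Ghat Y - g) ∂(complexLaw σ u g)

/-- `σ √(r^{2 / max(p,2)} log r / m)`; the exponent is `0` for `p = ∞`. -/
def rate (p : ℝ≥0∞) (σ : ℝ≥0) (r m : ℕ) : ℝ :=
  (σ : ℝ) * Real.sqrt ((r : ℝ) ^ (2 / max p 2).toReal * Real.log r / m)

end FIRIdent

end

/-!
On the `r`-th roots of unity the transfer functions of the filters `a cos (2 π k j / r)` with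
`k ≤ r / 2` have disjoint supports and a value of modulus at least `a r / 2`, so any two of the
filters are at `H∞` distance at least `a r / 2`. By Parseval, the energies of their responses to
inputs of total energy `E` average to at most `a² r E` over the `r` frequencies, so by Markov's
inequality at least `(3 / 8) r` frequencies `k ≤ r / 2` have response energy at most `8 a² r E`.
For Gaussian noise the likelihood ratio of such a hypothesis against the zero filter has second
moment at most `exp (8 a² r E / σ²)`. With `a² = σ² log r / (256 r E)` this is `r ^ (1 / 32)`, too
small for any estimator to tell all these hypotheses apart, and the risk is of order `a r`, that is
`σ √(r log r / E)`. Inputs in the unit ball of `ℓ^p` have total energy at most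
`E = m (2 r) ^ (1 - 2 / max p 2)`, by the power mean inequality.
-/

namespace FIRIdent

section SqDominated

variable {α β : Type*} [MeasurableSpace α] [MeasurableSpace β] {K L : ℝ≥0∞}

/-- `P` is dominated by `Q` in the `L²` sense with constant `K`. For `P ≪ Q` this says that the
second moment of `dP/dQ` under `Q`, that is `1 + χ²(P‖Q)`, is at most `K`; quantifying over test
functions makes the notion tensorize by Fubini's theorem alone. -/
def SqDominated (K : ℝ≥0∞) (P Q : Measure α) : Prop :=
  ∀ f : α → ℝ≥0∞, Measurable f → (∫⁻ x, f x ∂P) ^ 2 ≤ K * ∫⁻ x, f x ^ 2 ∂Q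

theorem SqDominated.mono {P Q : Measure α} (h : SqDominated K P Q) (hKL : K ≤ L) :
    SqDominated L P Q := fun f hf => (h f hf).trans (by gcongr)

theorem SqDominated.measure_sq_le {P Q : Measure α} (h : SqDominated K P Q) {B : Set α}
    (hB : MeasurableSet B) : P B ^ 2 ≤ K * Q B := by
  have hsq : (fun x => B.indicator (1 : α → ℝ≥0∞) x ^ 2) = B.indicator 1 := by
    funext x
    by_cases hx : x ∈ B <;> simp [hx]
  simpa only [hsq, lintegral_indicator_one hB] using h _ (measurable_one.indicator hB)

theorem SqDominated.map {P Q : Measure α} (h : SqDominated K P Q) {φ : α → β}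
    (hφ : Measurable φ) : SqDominated K (P.map φ) (Q.map φ) := fun f hf => by
  rw [lintegral_map hf hφ, lintegral_map (hf.pow_const 2) hφ]
  exact h _ (hf.comp hφ)

theorem SqDominated.prod {P Q : Measure α} {P' Q' : Measure β} [SFinite P] [SFinite P']
    [SFinite Q] [SFinite Q'] (h : SqDominated K P Q) (h' : SqDominated L P' Q') :
    SqDominated (K * L) (P.prod P') (Q.prod Q') := fun f hf => by
  rw [lintegral_prod _ hf.aemeasurable, lintegral_prod _ (hf.pow_const 2).aemeasurable]
  calc (∫⁻ x, ∫⁻ y, f (x, y) ∂P' ∂P) ^ 2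
      ≤ K * ∫⁻ x, (∫⁻ y, f (x, y) ∂P') ^ 2 ∂Q := h _ hf.lintegral_prod_right'
    _ ≤ K * ∫⁻ x, L * ∫⁻ y, f (x, y) ^ 2 ∂Q' ∂Q := by
        gcongr with x
        exact h' _ (hf.comp measurable_prodMk_left)
    _ = K * L * ∫⁻ x, ∫⁻ y, f (x, y) ^ 2 ∂Q' ∂Q := by
        rw [lintegral_const_mul _ (hf.pow_const 2).lintegral_prod_right', mul_assoc]

theorem SqDominated.pi_fin {n : ℕ} {α : Fin n → Type*} [∀ i, MeasurableSpace (α i)]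
    {K : Fin n → ℝ≥0∞} {P Q : ∀ i, Measure (α i)} [∀ i, SigmaFinite (P i)]
    [∀ i, SigmaFinite (Q i)] (h : ∀ i, SqDominated (K i) (P i) (Q i)) :
    SqDominated (∏ i, K i) (Measure.pi P) (Measure.pi Q) := by
  induction n with
  | zero =>
    intro f hf
    simp [Measure.pi_of_empty P, Measure.pi_of_empty Q, lintegral_dirac' _ hf,
      lintegral_dirac' _ (hf.pow_const 2)]
  | succ n ih =>
    have hP := (measurePreserving_piFinSuccAbove P 0).symm
    have hQ := (measurePreserving_piFinSuccAbove Q 0).symm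
    have hsplit := ((h 0).prod (ih fun i => h (Fin.succAbove 0 i))).map hP.measurable
    rwa [hP.map_eq, hQ.map_eq, ← Fin.prod_univ_succAbove K 0] at hsplit

theorem SqDominated.pi {ι : Type*} [Fintype ι] {α : ι → Type*} [∀ i, MeasurableSpace (α i)]
    {K : ι → ℝ≥0∞} {P Q : ∀ i, Measure (α i)} [∀ i, SigmaFinite (P i)]
    [∀ i, SigmaFinite (Q i)] (h : ∀ i, SqDominated (K i) (P i) (Q i)) :
    SqDominated (∏ i, K i) (Measure.pi P) (Measure.pi Q) := by
  let e := (Fintype.equivFin ι).symm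
  have hP := measurePreserving_piCongrLeft P e
  have hQ := measurePreserving_piCongrLeft Q e
  have hfin := (SqDominated.pi_fin fun i => h (e i)).map hP.measurable
  rwa [hP.map_eq, hQ.map_eq, e.prod_comp K] at hfin

theorem SqDominated.pi_exp {ι : Type*} [Fintype ι] {α : ι → Type*}
    [∀ i, MeasurableSpace (α i)] {c : ι → ℝ} {P Q : ∀ i, Measure (α i)}
    [∀ i, SigmaFinite (P i)] [∀ i, SigmaFinite (Q i)]
    (h : ∀ i, SqDominated (ENNReal.ofReal (Real.exp (c i))) (P i) (Q i)) :
    SqDominated (ENNReal.ofReal (Real.exp (∑ i, c i))) (Measure.pi P) (Measure.pi Q) := by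
  rw [Real.exp_sum, ENNReal.ofReal_prod_of_nonneg fun i _ => (Real.exp_pos _).le]
  exact SqDominated.pi h

theorem sqDominated_withDensity {μ : Measure α} {f g h : α → ℝ≥0∞} (hf : Measurable f)
    (hg : Measurable g) (hh : Measurable h) (hfgh : ∀ x, f x ^ 2 ≤ h x * g x) :
    SqDominated (∫⁻ x, h x ∂μ) (μ.withDensity f) (μ.withDensity g) := fun φ hφ => by
  rw [lintegral_withDensity_eq_lintegral_mul _ hf hφ,
    lintegral_withDensity_eq_lintegral_mul _ hg (hφ.pow_const 2)]
  have sq_rpow_half (a : ℝ≥0∞) : (a ^ 2) ^ (1 / 2 : ℝ) = a := by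
    rw [← ENNReal.rpow_natCast, ← ENNReal.rpow_mul]
    norm_num
  have rpow_half_sq (a : ℝ≥0∞) : (a ^ (1 / 2 : ℝ)) ^ 2 = a := by
    rw [← ENNReal.rpow_natCast, ← ENNReal.rpow_mul]
    norm_num
  have hpoint (x : α) :
      f x * φ x ≤ h x ^ (1 / 2 : ℝ) * (g x * φ x ^ 2) ^ (1 / 2 : ℝ) := by
    rw [← ENNReal.mul_rpow_of_nonneg _ _ (by norm_num), ← sq_rpow_half (f x * φ x), mul_pow,
      ← mul_assoc]
    gcongr
    exact hfgh x
  calc (∫⁻ x, f x * φ x ∂μ) ^ 2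
      ≤ (∫⁻ x, h x ^ (1 / 2 : ℝ) * (g x * φ x ^ 2) ^ (1 / 2 : ℝ) ∂μ) ^ 2 := by
        gcongr ?_ ^ 2
        exact lintegral_mono hpoint
    _ ≤ ((∫⁻ x, h x ∂μ) ^ (1 / 2 : ℝ) * (∫⁻ x, g x * φ x ^ 2 ∂μ) ^ (1 / 2 : ℝ)) ^ 2 := by
        gcongr
        exact ENNReal.lintegral_mul_norm_pow_le hh.aemeasurable
          (hg.mul (hφ.pow_const 2)).aemeasurable (by norm_num) (by norm_num) (by norm_num)
    _ = (∫⁻ x, h x ∂μ) * ∫⁻ x, g x * φ x ^ 2 ∂μ := by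
        rw [mul_pow, rpow_half_sq, rpow_half_sq]

end SqDominated

section Gaussian

variable {v : ℝ≥0}

theorem gaussianPDFReal_sq (μ ν : ℝ) (hv : v ≠ 0) (x : ℝ) :
    gaussianPDFReal μ v x ^ 2 = Real.exp ((μ - ν) ^ 2 / v) *
      gaussianPDFReal (2 * μ - ν) v x * gaussianPDFReal ν v x := by
  have hv' : (v : ℝ) ≠ 0 := by exact_mod_cast hv
  have hexp : Real.exp (-(x - μ) ^ 2 / (2 * v)) ^ 2 = Real.exp ((μ - ν) ^ 2 / v) *
      Real.exp (-(x - (2 * μ - ν)) ^ 2 / (2 * v)) * Real.exp (-(x - ν) ^ 2 / (2 * v)) := by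
    rw [← Real.exp_nat_mul, ← Real.exp_add, ← Real.exp_add]
    congr 1
    field_simp
    push_cast
    ring
  simp only [gaussianPDFReal, mul_pow, hexp]
  ring

theorem sqDominated_gaussianReal (μ ν : ℝ) (hv : v ≠ 0) :
    SqDominated (ENNReal.ofReal (Real.exp ((μ - ν) ^ 2 / v))) (gaussianReal μ v)
      (gaussianReal ν v) := by
  have hsq (x : ℝ) : gaussianPDF μ v x ^ 2 = ENNReal.ofReal (Real.exp ((μ - ν) ^ 2 / v)) *
      gaussianPDF (2 * μ - ν) v x * gaussianPDF ν v x := by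
    simp only [gaussianPDF]
    rw [← ENNReal.ofReal_pow (gaussianPDFReal_nonneg _ _ _), gaussianPDFReal_sq μ ν hv,
      ENNReal.ofReal_mul (by positivity [gaussianPDFReal_nonneg (2 * μ - ν) v x]),
      ENNReal.ofReal_mul (Real.exp_pos _).le]
  have hmass : ∫⁻ x, ENNReal.ofReal (Real.exp ((μ - ν) ^ 2 / v)) * gaussianPDF (2 * μ - ν) v x =
      ENNReal.ofReal (Real.exp ((μ - ν) ^ 2 / v)) := by
    rw [lintegral_const_mul _ (measurable_gaussianPDF _ _), lintegral_gaussianPDF_eq_one _ hv,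
      mul_one]
  rw [gaussianReal_of_var_ne_zero _ hv, gaussianReal_of_var_ne_zero _ hv, ← hmass]
  exact sqDominated_withDensity (measurable_gaussianPDF _ _) (measurable_gaussianPDF _ _)
    ((measurable_gaussianPDF _ _).const_mul _) fun x => (hsq x).le

instance isProbabilityMeasure_complexGaussian (μ : ℂ) (v : ℝ≥0) :
    IsProbabilityMeasure (complexGaussian μ v) :=
  Measure.isProbabilityMeasure_map Complex.measurableEquivRealProd.symm.measurable.aemeasurable

theorem sqDominated_complexGaussian (μ ν : ℂ) (hv : v ≠ 0) :
    SqDominated (ENNReal.ofReal (Real.exp (‖μ - ν‖ ^ 2 / v))) (complexGaussian μ v)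
      (complexGaussian ν v) := by
  rw [Complex.sq_norm, Complex.normSq_apply, ← sq, ← sq, add_div, Real.exp_add,
    ENNReal.ofReal_mul (Real.exp_pos _).le]
  exact ((sqDominated_gaussianReal μ.re ν.re hv).prod
    (sqDominated_gaussianReal μ.im ν.im hv)).map Complex.measurableEquivRealProd.symm.measurable

end Gaussian

section Testing

variable {Ω ι : Type*} [MeasurableSpace Ω] {S : Finset ι} {P : ι → Measure Ω} {Q : Measure Ω}
  [IsProbabilityMeasure Q] {K β : ℝ≥0∞}

theorem sum_measure_sq_le_of_sqDominated (hP : ∀ k ∈ S, SqDominated K (P k) Q) {B : ι → Set Ω}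
    (hB : ∀ k ∈ S, MeasurableSet (B k)) (hdisj : (S : Set ι).PairwiseDisjoint B) :
    ∑ k ∈ S, P k (B k) ^ 2 ≤ K :=
  calc ∑ k ∈ S, P k (B k) ^ 2 ≤ ∑ k ∈ S, K * Q (B k) :=
        Finset.sum_le_sum fun k hk => (hP k hk).measure_sq_le (hB k hk)
    _ = K * Q (⋃ k ∈ S, B k) := by rw [← Finset.mul_sum, measure_biUnion_finset hdisj hB]
    _ ≤ K := mul_le_of_le_one_right' prob_le_one

theorem exists_measure_le_of_sqDominated (hS : S.Nonempty)
    (hP : ∀ k ∈ S, SqDominated K (P k) Q) {B : ι → Set Ω} (hB : ∀ k ∈ S, MeasurableSet (B k))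
    (hdisj : (S : Set ι).PairwiseDisjoint B) (hK : K ≤ S.card * β ^ 2) :
    ∃ k ∈ S, P k (B k) ≤ β := by
  by_contra! hlt
  have hsum : ∑ _k ∈ S, β ^ 2 < ∑ k ∈ S, P k (B k) ^ 2 :=
    ENNReal.sum_lt_sum_of_nonempty hS fun k hk => ENNReal.pow_lt_pow_left two_ne_zero (hlt k hk)
  rw [Finset.sum_const, nsmul_eq_mul] at hsum
  exact ((sum_measure_sq_le_of_sqDominated hP hB hdisj).trans hK).not_gt hsum

/- The sets `{d k < δ}` are disjoint for `k ∈ S`, so one of them is improbable under `P k`. -/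
theorem exists_mul_le_lintegral_of_separated (hS : S.Nonempty)
    [∀ k, IsProbabilityMeasure (P k)] (hP : ∀ k ∈ S, SqDominated K (P k) Q)
    (hK : K ≤ S.card * β ^ 2) {d : ι → Ω → ℝ≥0∞} (hd : ∀ k ∈ S, Measurable (d k)) {δ : ℝ≥0∞}
    (hsep : ∀ k ∈ S, ∀ l ∈ S, k ≠ l → ∀ ω, 2 * δ ≤ d k ω + d l ω) :
    ∃ k ∈ S, δ * (1 - β) ≤ ∫⁻ ω, d k ω ∂P k := by
  have hB : ∀ k ∈ S, MeasurableSet {ω | d k ω < δ} := fun k hk =>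
    measurableSet_lt (hd k hk) measurable_const
  have hdisj : (S : Set ι).PairwiseDisjoint fun k => {ω | d k ω < δ} := by
    refine fun k hk l hl hkl => Set.disjoint_left.2 fun ω hωk hωl => ?_
    exact (hsep k hk l hl hkl ω).not_gt ((ENNReal.add_lt_add hωk hωl).trans_eq (two_mul δ).symm)
  obtain ⟨k, hk, hle⟩ := exists_measure_le_of_sqDominated hS hP hB hdisj hK
  refine ⟨k, hk, ?_⟩
  calc δ * (1 - β) ≤ δ * P k {ω | d k ω < δ}ᶜ := by
        rw [prob_compl_eq_one_sub (hB k hk)]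
        gcongr
    _ = δ * P k {ω | δ ≤ d k ω} := by simp only [Set.compl_ofPred, not_lt]
    _ ≤ ∫⁻ ω, d k ω ∂P k := mul_meas_ge_le_lintegral (hd k hk) δ

end Testing

section Filters

variable {r T m : ℕ}

theorem transfer_sub (g h : FIRFilter r) (z : ℂ) :
    transfer (g - h) z = transfer g z - transfer h z := by
  simp only [transfer, Pi.sub_apply, sub_mul, Finset.sum_sub_distrib]

theorem transfer_smul (a : ℂ) (g : FIRFilter r) (z : ℂ) :
    transfer (a • g) z = a * transfer g z := by
  simp only [transfer, Pi.smul_apply, smul_eq_mul, mul_assoc, Finset.mul_sum]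

theorem enorm_transfer_le_hinfNorm (g : FIRFilter r) {z : ℂ} (hz : ‖z‖ = 1) :
    ‖transfer g z‖ₑ ≤ hinfNorm g :=
  le_iSup (fun z : Circle => ‖transfer g (z : ℂ)‖ₑ) ⟨z, mem_sphere_zero_iff_norm.2 hz⟩

theorem hinfNorm_smul (a : ℂ) (g : FIRFilter r) : hinfNorm (a • g) = ‖a‖ₑ * hinfNorm g := by
  simp only [hinfNorm, transfer_smul, enorm_mul, ENNReal.mul_iSup]

theorem hinfNorm_sub_le_add (x g h : FIRFilter r) :
    hinfNorm (g - h) ≤ hinfNorm (x - g) + hinfNorm (x - h) := by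
  refine iSup_le fun z => ?_
  calc ‖transfer (g - h) (z : ℂ)‖ₑ = ‖transfer (x - h) (z : ℂ) - transfer (x - g) (z : ℂ)‖ₑ := by
        simp only [transfer_sub, sub_sub_sub_cancel_left]
    _ ≤ ‖transfer (x - h) (z : ℂ)‖ₑ + ‖transfer (x - g) (z : ℂ)‖ₑ := enorm_sub_le
    _ ≤ hinfNorm (x - h) + hinfNorm (x - g) := by
        gcongr <;> exact enorm_transfer_le_hinfNorm _ z.norm_coe
    _ = hinfNorm (x - g) + hinfNorm (x - h) := add_comm _ _

theorem measurable_hinfNorm : Measurable (hinfNorm : FIRFilter r → ℝ≥0∞) := by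
  refine (lowerSemicontinuous_iSup fun z => Continuous.lowerSemicontinuous ?_).measurable
  simp only [transfer]
  fun_prop

theorem ofRealFilter_smul (a : ℝ) (g : Fin r → ℝ) :
    ofRealFilter (a • g) = (a : ℂ) • ofRealFilter g := by
  ext j
  simp only [ofRealFilter, Pi.smul_apply, smul_eq_mul, Complex.ofReal_mul]

theorem conv_zero_left {R : Type*} [Semiring R] (u : Fin T → R) : conv (0 : Fin r → R) u = 0 := by
  funext k
  simp [conv]

theorem conv_smul_left {R : Type*} [Semiring R] (a : R) (g : Fin r → R) (u : Fin T → R) :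
    conv (a • g) u = a • conv g u := by
  funext k
  simp [conv, Finset.mul_sum, mul_assoc]

theorem conv_ofReal (g : Fin r → ℝ) (u : Fin T → ℝ) (t : Fin T) :
    conv (ofRealFilter g) (fun l => (u l : ℂ)) t = (conv g u t : ℝ) := by
  simp [conv, ofRealFilter, apply_ite Complex.ofReal]

/-- The energy `∑_i ‖x_i‖_2²` of `m` signals of length `T`. -/
def energy {E : Type*} [Norm E] (x : Fin m → Fin T → E) : ℝ := ∑ i, ∑ t, ‖x i t‖ ^ 2

theorem energy_smul {E : Type*} [NormedRing E] [NormMulClass E] (a : E) (x : Fin m → Fin T → E) :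
    energy (a • x) = ‖a‖ ^ 2 * energy x := by
  simp only [energy, Pi.smul_apply, smul_eq_mul, norm_mul, mul_pow, Finset.mul_sum]

end Filters

section Laws

variable {r T m : ℕ} {σ : ℝ≥0}

instance isProbabilityMeasure_realLaw (u : Fin m → Fin T → ℝ) (g : Fin r → ℝ) :
    IsProbabilityMeasure (realLaw σ u g) := by
  unfold realLaw
  infer_instance

instance isProbabilityMeasure_complexLaw (u : Fin m → Fin T → ℂ) (g : FIRFilter r) :
    IsProbabilityMeasure (complexLaw σ u g) := by
  unfold complexLaw
  infer_instance

theorem sqDominated_realLaw (hσ : σ ≠ 0) (u : Fin m → Fin T → ℝ) (g : Fin r → ℝ) :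
    SqDominated (ENNReal.ofReal (Real.exp (energy (fun i => conv g (u i)) / σ ^ 2)))
      (realLaw σ u g) (realLaw σ u (0 : Fin r → ℝ)) := by
  have h := SqDominated.pi_exp fun i => SqDominated.pi_exp fun t =>
    sqDominated_gaussianReal (conv g (u i) t) 0 (pow_ne_zero 2 hσ)
  simpa [realLaw, conv_zero_left, energy, Finset.sum_div] using h

theorem sqDominated_complexLaw (hσ : σ ≠ 0) (u : Fin m → Fin T → ℂ) (g : FIRFilter r) :
    SqDominated (ENNReal.ofReal (Real.exp (energy (fun i => conv g (u i)) / σ ^ 2)))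
      (complexLaw σ u g) (complexLaw σ u (0 : FIRFilter r)) := by
  have h := SqDominated.pi_exp fun i => SqDominated.pi_exp fun t =>
    sqDominated_complexGaussian (conv g (u i) t) 0 (pow_ne_zero 2 hσ)
  simpa [complexLaw, conv_zero_left, energy, Finset.sum_div] using h

end Laws

section Fourier

variable {r : ℕ}

theorem sum_zpow_pow_of_isPrimitiveRoot {F : Type*} [Field F] {ζ : F} (hζ : IsPrimitiveRoot ζ r)
    (n : ℤ) : ∑ j ∈ Finset.range r, (ζ ^ n) ^ j = if (r : ℤ) ∣ n then (r : F) else 0 := by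
  split_ifs with hdvd
  · simp [(hζ.zpow_eq_one_iff_dvd n).2 hdvd]
  · rw [geom_sum_eq (mt (hζ.zpow_eq_one_iff_dvd n).1 hdvd), ← zpow_natCast, zpow_comm,
      zpow_natCast, hζ.pow_eq_one, one_zpow, sub_self, zero_div]

theorem intCast_dvd_sub_iff_fin (j l : Fin r) : (r : ℤ) ∣ (j : ℤ) - (l : ℤ) ↔ j = l := by
  refine ⟨fun h => ?_, fun h => by simp [h]⟩
  have h0 := Int.eq_zero_of_abs_lt_dvd h (by rw [abs_lt]; omega)
  exact Fin.ext (by omega)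

theorem norm_sq_sum_mul_eq {ζ : ℂ} (hζ : ‖ζ‖ = 1) (k : ℕ) (x : Fin r → ℂ) :
    ((‖∑ j : Fin r, ζ ^ (k * (j : ℕ)) * x j‖ ^ 2 : ℝ) : ℂ) =
      ∑ j : Fin r, ∑ l : Fin r,
        x j * (starRingEnd ℂ) (x l) * (ζ ^ ((j : ℤ) - (l : ℤ))) ^ k := by
  have hζ0 : ζ ≠ 0 := norm_ne_zero_iff.1 (by simp [hζ])
  rw [Complex.ofReal_pow, ← Complex.mul_conj', map_sum, Finset.sum_mul_sum]
  refine Finset.sum_congr rfl fun j _ => Finset.sum_congr rfl fun l _ => ?_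
  rw [map_mul, map_pow, ← Complex.inv_eq_conj hζ, zpow_sub₀ hζ0, div_pow, zpow_natCast,
    zpow_natCast, ← pow_mul, ← pow_mul, mul_comm (j : ℕ), mul_comm (l : ℕ), inv_pow]
  ring

theorem sum_norm_sq_sum_pow_mul_eq {ζ : ℂ} (hζ : IsPrimitiveRoot ζ r) (x : Fin r → ℂ) :
    ∑ k ∈ Finset.range r, ‖∑ j : Fin r, ζ ^ (k * (j : ℕ)) * x j‖ ^ 2 = r * ∑ j, ‖x j‖ ^ 2 := by
  rcases eq_or_ne r 0 with rfl | hr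
  · simp
  have hζ1 : ‖ζ‖ = 1 := hζ.norm'_eq_one hr
  apply Complex.ofReal_injective
  rw [Complex.ofReal_sum]
  simp_rw [norm_sq_sum_mul_eq hζ1]
  rw [Finset.sum_comm]
  simp_rw [Finset.sum_comm (s := Finset.range r), ← Finset.mul_sum,
    sum_zpow_pow_of_isPrimitiveRoot hζ, intCast_dvd_sub_iff_fin]
  simp [Complex.mul_conj', Finset.mul_sum, mul_comm]

/-- The primitive `r`-th root of unity `exp (2 π i / r)`, whose powers are the frequencies of the
discrete Fourier transform. -/
noncomputable def dftRoot (r : ℕ) : ℂ := Complex.exp (2 * Real.pi * Complex.I / r)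

theorem isPrimitiveRoot_dftRoot (hr : r ≠ 0) : IsPrimitiveRoot (dftRoot r) r :=
  Complex.isPrimitiveRoot_exp r hr

/-- The real filter with coefficients `cos (2 π k j / r)`, `j < r`: the hypothesis at the frequency
`2 π k / r` in the testing argument. -/
noncomputable def cosFilter (r k : ℕ) : Fin r → ℝ :=
  fun j => Real.cos (2 * Real.pi * (k * (j : ℕ)) / r)

theorem ofReal_cosFilter (k : ℕ) (j : Fin r) :
    (cosFilter r k j : ℂ) =
      (dftRoot r ^ (k * (j : ℕ)) + (dftRoot r)⁻¹ ^ (k * (j : ℕ))) / 2 := by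
  rw [cosFilter, Complex.ofReal_cos, Complex.cos, dftRoot, ← Complex.exp_neg,
    ← Complex.exp_nat_mul, ← Complex.exp_nat_mul]
  push_cast
  ring_nf

theorem transfer_cosFilter (k l : ℕ) :
    transfer (ofRealFilter (cosFilter r l)) (dftRoot r ^ k) =
      ((if (r : ℤ) ∣ l - k then (r : ℂ) else 0) + if (r : ℤ) ∣ l + k then (r : ℂ) else 0) / 2 := by
  rcases eq_or_ne r 0 with rfl | hr
  · simp [transfer]
  have hζ := isPrimitiveRoot_dftRoot hr
  have hζ0 : dftRoot r ≠ 0 := hζ.ne_zero hr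
  have hterm (j : Fin r) : ofRealFilter (cosFilter r l) j * ((dftRoot r ^ k) ^ (j : ℕ))⁻¹ =
      ((dftRoot r ^ ((l : ℤ) - k)) ^ (j : ℕ) + (dftRoot r ^ (-((l : ℤ) + k))) ^ (j : ℕ)) / 2 := by
    rw [ofRealFilter, ofReal_cosFilter, zpow_sub₀ hζ0, zpow_neg, zpow_add₀ hζ0, zpow_natCast,
      zpow_natCast]
    simp only [pow_mul, div_pow, inv_pow, mul_pow]
    ring
  simp_rw [transfer, hterm]
  rw [← Finset.sum_div, Finset.sum_add_distrib,
    Fin.sum_univ_eq_sum_range (fun j => (dftRoot r ^ ((l : ℤ) - k)) ^ j),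
    Fin.sum_univ_eq_sum_range (fun j => (dftRoot r ^ (-((l : ℤ) + k))) ^ j),
    sum_zpow_pow_of_isPrimitiveRoot hζ, sum_zpow_pow_of_isPrimitiveRoot hζ]
  simp only [dvd_neg]

theorem transfer_cosFilter_of_ne {k l : ℕ} (hk : 2 * k ≤ r) (hl : 2 * l ≤ r) (hkl : k ≠ l) :
    transfer (ofRealFilter (cosFilter r l)) (dftRoot r ^ k) = 0 := by
  have hsub : ¬ (r : ℤ) ∣ l - k := fun h => by
    have := Int.eq_zero_of_abs_lt_dvd h (by rw [abs_lt]; omega)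
    omega
  have hadd : ¬ (r : ℤ) ∣ l + k := fun h => by
    have := Int.eq_zero_of_abs_lt_dvd h (by rw [abs_lt]; omega)
    omega
  simp [transfer_cosFilter, hsub, hadd]

theorem half_le_norm_transfer_cosFilter (k : ℕ) :
    (r : ℝ) / 2 ≤ ‖transfer (ofRealFilter (cosFilter r k)) (dftRoot r ^ k)‖ := by
  rw [transfer_cosFilter, sub_self, if_pos (dvd_zero _), norm_div, Complex.norm_two]
  gcongr
  split_ifs
  · rw [← Nat.cast_add, Complex.norm_natCast, Nat.cast_add]
    linarith
  · simp

theorem half_le_hinfNorm_cosFilter_sub {k l : ℕ} (hk : 2 * k ≤ r) (hl : 2 * l ≤ r)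
    (hkl : k ≠ l) :
    ENNReal.ofReal (r / 2) ≤
      hinfNorm (ofRealFilter (cosFilter r k) - ofRealFilter (cosFilter r l)) := by
  have hr : r ≠ 0 := by omega
  have hnorm : ‖dftRoot r ^ k‖ = 1 := by
    rw [norm_pow, (isPrimitiveRoot_dftRoot hr).norm'_eq_one hr, one_pow]
  refine le_trans ?_ (enorm_transfer_le_hinfNorm _ hnorm)
  rw [transfer_sub, transfer_cosFilter_of_ne hk hl hkl, sub_zero, ← ofReal_norm]
  exact ENNReal.ofReal_le_ofReal (half_le_norm_transfer_cosFilter k)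

end Fourier

section CosineEnergy

variable {r T m : ℕ}

theorem norm_half_add_sq_le {E : Type*} [SeminormedAddCommGroup E] [NormedSpace ℝ E] (a b : E) :
    ‖(2⁻¹ : ℝ) • (a + b)‖ ^ 2 ≤ (‖a‖ ^ 2 + ‖b‖ ^ 2) / 2 := by
  rw [norm_smul, mul_pow]
  have h : ‖a + b‖ ^ 2 ≤ 2 * (‖a‖ ^ 2 + ‖b‖ ^ 2) :=
    (pow_le_pow_left₀ (norm_nonneg _) (norm_add_le a b) 2).trans add_sq_le
  norm_num
  linarith

theorem sum_norm_sq_sum_cosFilter_mul_le (x : Fin r → ℂ) :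
    ∑ k ∈ Finset.range r, ‖∑ j : Fin r, (cosFilter r k j : ℂ) * x j‖ ^ 2 ≤
      r * ∑ j, ‖x j‖ ^ 2 := by
  rcases eq_or_ne r 0 with rfl | hr
  · simp
  have hζ := isPrimitiveRoot_dftRoot hr
  set a := fun k : ℕ => ∑ j : Fin r, dftRoot r ^ (k * (j : ℕ)) * x j
  set b := fun k : ℕ => ∑ j : Fin r, (dftRoot r)⁻¹ ^ (k * (j : ℕ)) * x j
  have hsplit (k : ℕ) : ∑ j : Fin r, (cosFilter r k j : ℂ) * x j = (2⁻¹ : ℝ) • (a k + b k) := by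
    simp only [a, b, ofReal_cosFilter, ← Finset.sum_add_distrib, Finset.smul_sum,
      Complex.real_smul]
    push_cast
    exact Finset.sum_congr rfl fun j _ => by ring
  calc ∑ k ∈ Finset.range r, ‖∑ j : Fin r, (cosFilter r k j : ℂ) * x j‖ ^ 2
      ≤ ∑ k ∈ Finset.range r, (‖a k‖ ^ 2 + ‖b k‖ ^ 2) / 2 := by
        simp only [hsplit]
        gcongr
        exact norm_half_add_sq_le _ _
    _ = r * ∑ j, ‖x j‖ ^ 2 := by
        rw [← Finset.sum_div, Finset.sum_add_distrib, sum_norm_sq_sum_pow_mul_eq hζ,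
          sum_norm_sq_sum_pow_mul_eq hζ.inv]
        ring

/-- The signal `u` delayed by `j` steps and cut off at time `T`. -/
def delay {E : Type*} [AddCommMonoid E] (j : ℕ) (u : Fin T → E) : Fin T → E :=
  fun t => ∑ l : Fin T, if j + (l : ℕ) = t then u l else 0

theorem conv_eq_sum_mul_delay {R : Type*} [Semiring R] (g : Fin r → R) (u : Fin T → R)
    (t : Fin T) : conv g u t = ∑ j : Fin r, g j * delay j u t := by
  simp only [conv, delay, Finset.mul_sum, mul_ite, mul_zero]

theorem norm_sq_delay {E : Type*} [SeminormedAddCommGroup E] (j : ℕ) (u : Fin T → E)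
    (t : Fin T) : ‖delay j u t‖ ^ 2 = ∑ l : Fin T, if j + (l : ℕ) = t then ‖u l‖ ^ 2 else 0 := by
  by_cases h : ∃ l : Fin T, j + (l : ℕ) = t
  · obtain ⟨l, hl⟩ := h
    have hiff (l' : Fin T) : j + (l' : ℕ) = t ↔ l' = l := by
      rw [← hl, Nat.add_left_cancel_iff, Fin.ext_iff]
    simp [delay, hiff]
  · push Not at h
    simp [delay, h]

theorem sum_norm_sq_delay_le {E : Type*} [SeminormedAddCommGroup E] (j : ℕ) (u : Fin T → E) :
    ∑ t, ‖delay j u t‖ ^ 2 ≤ ∑ l, ‖u l‖ ^ 2 := by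
  simp_rw [norm_sq_delay]
  rw [Finset.sum_comm]
  refine Finset.sum_le_sum fun l _ => ?_
  rw [Fin.sum_univ_eq_sum_range (fun t => if j + (l : ℕ) = t then ‖u l‖ ^ 2 else 0),
    Finset.sum_ite_eq]
  split_ifs
  exacts [le_rfl, by positivity]

theorem sum_norm_sq_conv_cosFilter_le (u : Fin T → ℂ) :
    ∑ k ∈ Finset.range r, ∑ t, ‖conv (ofRealFilter (cosFilter r k)) u t‖ ^ 2 ≤
      r ^ 2 * ∑ l, ‖u l‖ ^ 2 := by
  rw [Finset.sum_comm]
  calc ∑ t, ∑ k ∈ Finset.range r, ‖conv (ofRealFilter (cosFilter r k)) u t‖ ^ 2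
      ≤ ∑ t, r * ∑ j : Fin r, ‖delay j u t‖ ^ 2 := by
        simp_rw [conv_eq_sum_mul_delay]
        exact Finset.sum_le_sum fun t _ => sum_norm_sq_sum_cosFilter_mul_le _
    _ = r * ∑ j : Fin r, ∑ t, ‖delay j u t‖ ^ 2 := by rw [← Finset.mul_sum, Finset.sum_comm]
    _ ≤ r * ∑ _j : Fin r, ∑ l, ‖u l‖ ^ 2 := by
        gcongr r * ∑ j, ?_ with j
        exact sum_norm_sq_delay_le _ u
    _ = r ^ 2 * ∑ l, ‖u l‖ ^ 2 := by simp [sq, mul_assoc]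

theorem sum_energy_conv_cosFilter_le (u : Fin m → Fin T → ℂ) :
    ∑ k ∈ Finset.range r, energy (fun i => conv (ofRealFilter (cosFilter r k)) (u i)) ≤
      r ^ 2 * energy u := by
  simp only [energy]
  rw [Finset.sum_comm, Finset.mul_sum]
  exact Finset.sum_le_sum fun i _ => sum_norm_sq_conv_cosFilter_le (u i)

theorem exists_frequencies_energy_le (hr : 2 ≤ r) (u : Fin m → Fin T → ℂ) {E : ℝ} (hE : 0 < E)
    (hu : energy u ≤ E) :
    ∃ S : Finset ℕ, 2 ≤ S.card ∧ 3 * r ≤ 8 * S.card ∧ ∀ k ∈ S, 2 * k ≤ r ∧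
      energy (fun i => conv (ofRealFilter (cosFilter r k)) (u i)) ≤ 8 * r * E := by
  set e : ℕ → ℝ := fun k => energy fun i => conv (ofRealFilter (cosFilter r k)) (u i)
  set F := Finset.range (r / 2 + 1)
  set bad := F.filter fun k => ¬ e k ≤ 8 * r * E
  have hbad : 8 * bad.card ≤ r := by
    have hsub : bad ⊆ Finset.range r := fun k hk => by
      have := Finset.mem_range.1 (Finset.mem_filter.1 hk).1
      exact Finset.mem_range.2 (by omega)
    have hmarkov : bad.card • (8 * r * E) ≤ r ^ 2 * E :=
      calc bad.card • (8 * r * E) ≤ ∑ k ∈ bad, e k := Finset.card_nsmul_le_sum _ _ _ fun k hk =>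
            (not_le.1 (Finset.mem_filter.1 hk).2).le
        _ ≤ ∑ k ∈ Finset.range r, e k :=
            Finset.sum_le_sum_of_subset_of_nonneg hsub fun k _ _ => by
              simp only [e, energy]
              positivity
        _ ≤ r ^ 2 * energy u := sum_energy_conv_cosFilter_le u
        _ ≤ r ^ 2 * E := by gcongr
    have hrE : 0 < r * E := by positivity
    rw [nsmul_eq_mul] at hmarkov
    have hreal : (8 * bad.card : ℝ) ≤ r := le_of_mul_le_mul_right (by linarith) hrE
    exact_mod_cast hreal
  have hcard : (F.filter fun k => e k ≤ 8 * r * E).card + bad.card = r / 2 + 1 := by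
    rw [Finset.card_filter_add_card_filter_not, Finset.card_range]
  refine ⟨F.filter fun k => e k ≤ 8 * r * E, by omega, by omega, fun k hk => ?_⟩
  obtain ⟨hkF, hke⟩ := Finset.mem_filter.1 hk
  exact ⟨by have := Finset.mem_range.1 hkF; omega, hke⟩

end CosineEnergy

section RiskBound

variable {r T m : ℕ}

theorem ofReal_exp_log_div_le_card_mul {n : ℕ} (hr : r ≠ 0) (hn : 2 ≤ n) (hrn : 3 * r ≤ 8 * n) :
    ENNReal.ofReal (Real.exp (Real.log r / 32)) ≤ n * ENNReal.ofReal (3 / 4) ^ 2 := by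
  set t : ℝ := 9 / 16 * n
  have hn' : (2 : ℝ) ≤ n := by exact_mod_cast hn
  have hrn' : (3 * r : ℝ) ≤ 8 * n := by exact_mod_cast hrn
  have ht : 9 / 8 ≤ t := by simp only [t]; linarith
  have hr0 : (0 : ℝ) < r := by positivity
  have hrt : (r : ℝ) ≤ t ^ 32 :=
    calc (r : ℝ) ≤ (9 / 8) ^ 31 * t := by simp only [t]; linarith
      _ ≤ t ^ 31 * t := by gcongr
      _ = t ^ 32 := (pow_succ t 31).symm
  have hexp : Real.exp (Real.log r / 32) ≤ t := by
    rw [← Real.le_log_iff_exp_le (by linarith), div_le_iff₀ (by norm_num), mul_comm]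
    simpa only [Real.log_pow, Nat.cast_ofNat] using Real.log_le_log hr0 hrt
  calc ENNReal.ofReal (Real.exp (Real.log r / 32)) ≤ ENNReal.ofReal t :=
        ENNReal.ofReal_le_ofReal hexp
    _ = n * ENNReal.ofReal (3 / 4) ^ 2 := by
        rw [← ENNReal.ofReal_pow (by norm_num), ← ENNReal.ofReal_natCast,
          ← ENNReal.ofReal_mul (by positivity)]
        congr 1
        simp only [t]
        ring

theorem two_mul_le_hinfNorm_add_cosFilter {k l : ℕ} (hk : 2 * k ≤ r) (hl : 2 * l ≤ r)
    (hkl : k ≠ l) {a : ℝ} (ha : 0 ≤ a) (x : FIRFilter r) :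
    2 * ENNReal.ofReal (a * r / 4) ≤ hinfNorm (x - ofRealFilter (a • cosFilter r k)) +
      hinfNorm (x - ofRealFilter (a • cosFilter r l)) :=
  calc 2 * ENNReal.ofReal (a * r / 4) = ‖(a : ℂ)‖ₑ * ENNReal.ofReal (r / 2) := by
        rw [← ofReal_norm, Complex.norm_of_nonneg ha, ← ENNReal.ofReal_mul ha,
          ← ENNReal.ofReal_ofNat, ← ENNReal.ofReal_mul (by norm_num)]
        ring_nf
    _ ≤ ‖(a : ℂ)‖ₑ * hinfNorm (ofRealFilter (cosFilter r k) - ofRealFilter (cosFilter r l)) := by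
        gcongr
        exact half_le_hinfNorm_cosFilter_sub hk hl hkl
    _ ≤ hinfNorm (x - ofRealFilter (a • cosFilter r k)) +
          hinfNorm (x - ofRealFilter (a • cosFilter r l)) := by
        rw [← hinfNorm_smul, smul_sub, ← ofRealFilter_smul, ← ofRealFilter_smul]
        exact hinfNorm_sub_le_add _ _ _

theorem energy_conv_smul_ofRealFilter (a : ℝ) (g : Fin r → ℝ) (u : Fin m → Fin T → ℂ) :
    energy (fun i => conv (ofRealFilter (a • g)) (u i)) =
      a ^ 2 * energy fun i => conv (ofRealFilter g) (u i) := by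
  rw [← sq_abs, ← Real.norm_eq_abs, ← Complex.norm_real, ← energy_smul]
  simp only [ofRealFilter_smul, conv_smul_left]
  rfl

theorem exists_le_lintegral_hinfNorm {Ω : Type*} [MeasurableSpace Ω] (hr : 2 ≤ r) {σ : ℝ≥0}
    (hσ : σ ≠ 0) {E : ℝ} (hE : 0 < E) {u : Fin m → Fin T → ℂ} (hu : energy u ≤ E)
    (P : (Fin r → ℝ) → Measure Ω) [∀ g, IsProbabilityMeasure (P g)] {Q : Measure Ω}
    [IsProbabilityMeasure Q] (hP : ∀ g, SqDominated
      (ENNReal.ofReal (Real.exp (energy (fun i => conv (ofRealFilter g) (u i)) / σ ^ 2))) (P g) Q)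
    {Ghat : Ω → FIRFilter r} (hG : Measurable Ghat) :
    ∃ g : Fin r → ℝ, ENNReal.ofReal (σ * √(r * Real.log r / E) / 256) ≤
      ∫⁻ Y, hinfNorm (Ghat Y - ofRealFilter g) ∂P g := by
  have hr0 : (0 : ℝ) < r := by positivity
  have hσ0 : (σ : ℝ) ≠ 0 := by exact_mod_cast hσ
  obtain ⟨S, hS2, hrS, hS⟩ := exists_frequencies_energy_le hr u hE hu
  set a : ℝ := σ / 16 * √(Real.log r / (r * E))
  have ha : 0 ≤ a := by positivity
  have hasq : a ^ 2 * (8 * r * E) / σ ^ 2 = Real.log r / 32 := by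
    simp only [a]
    rw [mul_pow, Real.sq_sqrt (by positivity)]
    field_simp
    ring
  have har : a * r / 4 * (1 - 3 / 4) = σ * √(r * Real.log r / E) / 256 := by
    have : r * Real.log r / E = r ^ 2 * (Real.log r / (r * E)) := by field_simp
    rw [this, Real.sqrt_mul (sq_nonneg _), Real.sqrt_sq hr0.le]
    ring
  have hdom (k : ℕ) (hk : k ∈ S) : SqDominated (ENNReal.ofReal (Real.exp (Real.log r / 32)))
      (P (a • cosFilter r k)) Q := by
    refine (hP (a • cosFilter r k)).mono ?_
    rw [← hasq, energy_conv_smul_ofRealFilter]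
    gcongr
    exact (hS k hk).2
  obtain ⟨k, -, hle⟩ := exists_mul_le_lintegral_of_separated (β := ENNReal.ofReal (3 / 4))
    (P := fun k => P (a • cosFilter r k)) (Q := Q)
    (d := fun k Y => hinfNorm (Ghat Y - ofRealFilter (a • cosFilter r k)))
    (Finset.card_pos.1 (by omega)) hdom (ofReal_exp_log_div_le_card_mul (by omega) hS2 hrS)
    (fun k _ => measurable_hinfNorm.comp (hG.sub_const _))
    (fun k hk l hl hkl Y =>
      two_mul_le_hinfNorm_add_cosFilter (hS k hk).1 (hS l hl).1 hkl ha (Ghat Y))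
  refine ⟨a • cosFilter r k, le_of_eq_of_le ?_ hle⟩
  rw [← har, ENNReal.ofReal_mul (by positivity), ENNReal.ofReal_sub _ (by norm_num),
    ENNReal.ofReal_one]

theorem energy_conv_ofReal (g : Fin r → ℝ) (u : Fin m → Fin T → ℝ) :
    energy (fun i => conv (ofRealFilter g) fun t => (u i t : ℂ)) =
      energy fun i => conv g (u i) := by
  simp only [energy, conv_ofReal, Complex.norm_real]

theorem ofReal_le_realMinimaxRisk (hr : 2 ≤ r) {σ : ℝ≥0} (hσ : σ ≠ 0) {E : ℝ} (hE : 0 < E)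
    {u : Fin m → Fin T → ℝ} (hu : energy u ≤ E) :
    ENNReal.ofReal (σ * √(r * Real.log r / E) / 256) ≤ realMinimaxRisk r σ u := by
  refine le_iInf₂ fun Ghat hG => ?_
  obtain ⟨g, hg⟩ := exists_le_lintegral_hinfNorm (u := fun i t => (u i t : ℂ)) hr hσ hE
    (by simpa [energy] using hu) (realLaw σ u)
    (fun g => by simpa only [energy_conv_ofReal] using sqDominated_realLaw hσ u g) hG
  exact hg.trans (le_iSup (fun g => ∫⁻ Y, hinfNorm (Ghat Y - ofRealFilter g) ∂realLaw σ u g) g)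

theorem ofReal_le_complexMinimaxRisk (hr : 2 ≤ r) {σ : ℝ≥0} (hσ : σ ≠ 0) {E : ℝ} (hE : 0 < E)
    {u : Fin m → Fin T → ℂ} (hu : energy u ≤ E) :
    ENNReal.ofReal (σ * √(r * Real.log r / E) / 256) ≤ complexMinimaxRisk r σ u := by
  refine le_iInf₂ fun Ghat hG => ?_
  obtain ⟨g, hg⟩ := exists_le_lintegral_hinfNorm hr hσ hE hu
    (fun g => complexLaw σ u (ofRealFilter g)) (fun g => sqDominated_complexLaw hσ u _) hG
  exact hg.trans (le_iSup (fun g => ∫⁻ Y, hinfNorm (Ghat Y - g) ∂complexLaw σ u g) _)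

end RiskBound

section LpBall

variable {ι E : Type*} [Fintype ι] [SeminormedAddCommGroup E] {p : ℝ≥0∞}

theorem sum_norm_rpow_le_one (hp : 1 ≤ p) (hp' : p ≠ ∞) {u : ι → E}
    (hu : ‖WithLp.toLp p u‖ ≤ 1) : ∑ t, ‖u t‖ ^ p.toReal ≤ 1 := by
  have hq : 0 < p.toReal := ENNReal.toReal_pos (one_pos.trans_le hp).ne' hp'
  rw [PiLp.norm_eq_sum hq] at hu
  by_contra! hlt
  exact (Real.one_lt_rpow hlt (by positivity)).not_ge hu

theorem sum_norm_sq_le_card_of_linfty {u : ι → E} (hu : ‖WithLp.toLp ∞ u‖ ≤ 1) :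
    ∑ t, ‖u t‖ ^ 2 ≤ Fintype.card ι := by
  have hle (t : ι) : ‖u t‖ ≤ 1 := (PiLp.norm_apply_le (WithLp.toLp ∞ u) t).trans hu
  calc ∑ t, ‖u t‖ ^ 2 ≤ ∑ _t : ι, (1 : ℝ) :=
        Finset.sum_le_sum fun t _ => pow_le_one₀ (norm_nonneg _) (hle t)
    _ = Fintype.card ι := by simp

theorem sum_norm_sq_le_one_of_le_two (hp : 1 ≤ p) (hp2 : p ≤ 2) {u : ι → E}
    (hu : ‖WithLp.toLp p u‖ ≤ 1) : ∑ t, ‖u t‖ ^ 2 ≤ 1 := by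
  have : Fact (1 ≤ p) := ⟨hp⟩
  have hle (t : ι) : ‖u t‖ ≤ 1 := (PiLp.norm_apply_le (WithLp.toLp p u) t).trans hu
  refine le_trans (Finset.sum_le_sum fun t _ => ?_)
    (sum_norm_rpow_le_one hp (ne_top_of_le_ne_top (by simp) hp2) hu)
  rw [← Real.rpow_two]
  exact Real.rpow_le_rpow_of_exponent_ge' (norm_nonneg _) (hle t) ENNReal.toReal_nonneg
    (by simpa using ENNReal.toReal_mono (by simp) hp2)

theorem sum_sq_le_rpow_of_sum_rpow_le_one {q : ℝ} (hq : 2 ≤ q) {x : ι → ℝ} (hx : ∀ t, 0 ≤ x t)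
    (hsum : ∑ t, x t ^ q ≤ 1) : ∑ t, x t ^ 2 ≤ (Fintype.card ι : ℝ) ^ (1 - 2 / q) := by
  have hpow (t : ι) : (x t ^ 2) ^ (q / 2) = x t ^ q := by
    rw [← Real.rpow_two, ← Real.rpow_mul (hx t), mul_div_cancel₀ q two_ne_zero]
  have hmean : (∑ t, x t ^ 2) ^ (q / 2) ≤ (Fintype.card ι : ℝ) ^ (q / 2 - 1) := by
    refine (Real.rpow_sum_le_const_mul_sum_rpow_of_nonneg Finset.univ (by linarith)
      fun t _ => sq_nonneg (x t)).trans ?_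
    simp only [hpow, Finset.card_univ]
    exact mul_le_of_le_one_right (by positivity) hsum
  calc ∑ t, x t ^ 2 = ((∑ t, x t ^ 2) ^ (q / 2)) ^ (2 / q) := by
        rw [← Real.rpow_mul (by positivity), div_mul_div_cancel₀ two_ne_zero,
          div_self (by positivity), Real.rpow_one]
    _ ≤ ((Fintype.card ι : ℝ) ^ (q / 2 - 1)) ^ (2 / q) := by gcongr
    _ = (Fintype.card ι : ℝ) ^ (1 - 2 / q) := by
        rw [← Real.rpow_mul (by positivity)]
        congr 1
        field_simp

theorem sum_norm_sq_le_of_lp_norm_le_one (hp : 1 ≤ p) {u : ι → E}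
    (hu : ‖WithLp.toLp p u‖ ≤ 1) :
    ∑ t, ‖u t‖ ^ 2 ≤ (Fintype.card ι : ℝ) ^ (1 - (2 / max p 2).toReal) := by
  rcases le_total p 2 with hp2 | hp2
  · rw [max_eq_right hp2, ENNReal.div_self (by simp) (by simp)]
    simpa using sum_norm_sq_le_one_of_le_two hp hp2 hu
  rcases eq_or_ne p ∞ with rfl | hp'
  · simpa using sum_norm_sq_le_card_of_linfty hu
  · rw [max_eq_left hp2, ENNReal.toReal_div, ENNReal.toReal_ofNat]
    exact sum_sq_le_rpow_of_sum_rpow_le_one (by simpa using ENNReal.toReal_mono hp' hp2)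
      (fun t => norm_nonneg (u t)) (sum_norm_rpow_le_one hp hp' hu)

theorem energy_le_of_lp_norm_le_one {T m : ℕ} (hp : 1 ≤ p) {u : Fin m → Fin T → E}
    (hu : ∀ i, ‖WithLp.toLp p (u i)‖ ≤ 1) :
    energy u ≤ m * (T : ℝ) ^ (1 - (2 / max p 2).toReal) := by
  simpa [energy, -ENNReal.toReal_div] using Finset.sum_le_card_nsmul Finset.univ _ _ fun i _ =>
    sum_norm_sq_le_of_lp_norm_le_one hp (hu i)

theorem rate_le (p : ℝ≥0∞) (σ : ℝ≥0) {r : ℕ} (hr : r ≠ 0) (m : ℕ) :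
    rate p σ r m ≤ 2 * (σ * √(r * Real.log r /
      (m * ((2 * r : ℕ) : ℝ) ^ (1 - (2 / max p 2).toReal)))) := by
  set s := (2 / max p 2).toReal
  have hr0 : (0 : ℝ) < r := by positivity
  have hs : 0 ≤ s := ENNReal.toReal_nonneg
  have hpow : ((2 * r : ℕ) : ℝ) ^ (1 - s) ≤ 2 ^ 2 * (r / r ^ s) := by
    rw [Nat.cast_mul, Real.mul_rpow (by positivity) hr0.le, Nat.cast_ofNat, Real.rpow_sub hr0,
      Real.rpow_one, ← Real.rpow_two]
    gcongr <;> linarith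
  have hratio : (r : ℝ) ^ s * Real.log r / m ≤
      2 ^ 2 * (r * Real.log r / (m * ((2 * r : ℕ) : ℝ) ^ (1 - s))) := by
    rw [mul_comm (m : ℝ), ← div_div, ← mul_div_assoc]
    refine div_le_div_of_nonneg_right ?_ m.cast_nonneg
    calc (r : ℝ) ^ s * Real.log r = 2 ^ 2 * (r * Real.log r / (2 ^ 2 * (r / r ^ s))) := by
          field_simp
      _ ≤ 2 ^ 2 * (r * Real.log r / ((2 * r : ℕ) : ℝ) ^ (1 - s)) := by gcongr
  rw [rate, mul_left_comm, ← Real.sqrt_sq (zero_le_two (α := ℝ)), ← Real.sqrt_mul (by positivity)]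
  gcongr

end LpBall

end FIRIdent

theorem theorem3_general (r : ℕ) {T m : ℕ} (σ : ℝ≥0) {E : ℝ} (hE : 0 < E) :
    (∀ u : Fin m → Fin T → ℝ, FIRIdent.energy u ≤ E →
      ENNReal.ofReal (σ * √(r * Real.log r / E) / 256) ≤ FIRIdent.realMinimaxRisk r σ u) ∧
    (∀ u : Fin m → Fin T → ℂ, FIRIdent.energy u ≤ E →
      ENNReal.ofReal (σ * √(r * Real.log r / E) / 256) ≤ FIRIdent.complexMinimaxRisk r σ u) := by
  rcases eq_or_ne σ 0 with rfl | hσ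
  · simp
  rcases lt_or_ge r 2 with hr | hr
  · interval_cases r <;> simp
  · exact ⟨fun u hu => FIRIdent.ofReal_le_realMinimaxRisk hr hσ hE hu,
      fun u hu => FIRIdent.ofReal_le_complexMinimaxRisk hr hσ hE hu⟩

theorem theorem3 :
    ∃ C : ℝ, 0 < C ∧
      ∀ (p : ℝ≥0∞) (_ : 1 ≤ p) (r : ℕ) (_ : 16 ≤ r) (m : ℕ) (_ : 1 ≤ m) (σ : ℝ≥0),
        (∀ u : Fin m → Fin (2 * r) → ℝ, (∀ i, ‖WithLp.toLp p (u i)‖ ≤ 1) →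
          ENNReal.ofReal (C * FIRIdent.rate p σ r m) ≤ FIRIdent.realMinimaxRisk r σ u) ∧
        (∀ u : Fin m → Fin (2 * r) → ℂ, (∀ i, ‖WithLp.toLp p (u i)‖ ≤ 1) →
          ENNReal.ofReal (C * FIRIdent.rate p σ r m) ≤
            FIRIdent.complexMinimaxRisk r σ u) := by
  refine ⟨1 / 512, by norm_num, fun p hp r hr m hm σ => ?_⟩
  have hbound := theorem3_general r (T := 2 * r) (m := m) σ
    (E := m * ((2 * r : ℕ) : ℝ) ^ (1 - (2 / max p 2).toReal)) (by positivity)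
  have hrate := FIRIdent.rate_le p σ (by omega : r ≠ 0) m
  refine ⟨fun u hu => (ENNReal.ofReal_le_ofReal ?_).trans
      (hbound.1 u (FIRIdent.energy_le_of_lp_norm_le_one hp hu)),
    fun u hu => (ENNReal.ofReal_le_ofReal ?_).trans
      (hbound.2 u (FIRIdent.energy_le_of_lp_norm_le_one hp hu))⟩ <;> linarith
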